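/- **Width by grounded slices.** For a well-quasi-order $A$, let $\mathrm{Inco}(A)$ be the tree of non-empty finite sequences of pairwise incomparable elements of $A$, where the children of $s$ are the one-element extensions $s\frown y$ in $\mathrm{Inco}(A)$. A node $s$ has rank $r(s)=\sup\{r(t)+1 : t \text{ a child of } s\}$, and the *width* of $A$ is the ordinal $w(A)=\sup\{r(s)+1 : s\in \mathrm{Inco}(A)\}$. Let $\oplus$ denote the natural (Hessenberg) sum of ordinals, which adds Cantor normal forms coefficient by coefficient. Let $n\geq 1$, let $\alpha_1,\dots,\alpha_n$ be infinite ordinals, and let $X=\alpha_1\times\dots\times\alpha_n$ with the componentwise order. Write each $\alpha_i$ in Cantor normal form without multiplicities, $$\alpha_i=\sum_{j<l_i}\omega^{\alpha_{i,j}},\qquad \alpha_{i,0}\geq\dots\geq\alpha_{i,l_i-1}.$$ For a tuple $s=(s(1),\dots,s(n))$ with $0\leq s(i)<l_i$, define the slice $$X_s=\Bigl\{(\delta_1,\dots,\delta_n)\in X : \sum_{j<s(i)}\omega^{\alpha_{i,j}}\leq\delta_i<\sum_{j\leq s(i)}\omega^{\alpha_{i,j}}\text{ for all } i\Bigr\},$$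 with the order induced from $X$. Call $s$ grounded if $s(k)=0$ for some $k$, and let $\mathrm{Gr}(X)$ be the set of grounded $s$. Then $$w(X)=\bigoplus_{s\in \mathrm{Gr}(X)} w(X_s).$$ -/

import Mathlib

universe u v

open scoped Ordinal

namespace OrdWidth

/-! ### The width of a well-quasi-order -/

/-- A substructure of a well-quasi-order is a well-quasi-order. -/
instance subtypeWqo {A : Type u} [Preorder A] [WellQuasiOrderedLE A] (S : Set A) :
    WellQuasiOrderedLE S :=
  ⟨fun f => wellQuasiOrdered_le fun k => (f k : A)⟩

/-- The nodes of the tree `Inco(A)`: the non-empty finite sequences of pairwise incomparable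
elements of `A`. -/
def Inco (A : Type u) [Preorder A] : Type u :=
  {l : List A // l ≠ [] ∧ l.Pairwise (IncompRel (· ≤ ·))}

/-- `t` is a child of `s` in `Inco(A)` when `t` extends `s` by exactly one element. -/
def Inco.IsChild {A : Type u} [Preorder A] (t s : Inco A) : Prop :=
  ∃ y : A, t.1 = s.1 ++ [y]

/-- The tree `Inco(A)` of a well-quasi-order has no infinite branch. -/
instance Inco.isWellFounded (A : Type u) [Preorder A] [WellQuasiOrderedLE A] :
    IsWellFounded (Inco A) Inco.IsChild := by
  refine ⟨wellFounded_iff_isEmpty_descending_chain.2 ⟨fun ⟨f, hf⟩ => ?_⟩⟩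
  choose y hy using hf
  have mem : ∀ m n, m < n → y m ∈ (f n).1 := by
    intro m n h
    induction n with
    | zero => omega
    | succ n ih =>
      rw [hy n, List.mem_append]
      rcases Nat.lt_succ_iff_lt_or_eq.1 h with h | rfl
      · exact Or.inl (ih h)
      · simp
  obtain ⟨m, n, hmn, hle⟩ := wellQuasiOrdered_le (α := A) y
  have hp := (f (n + 1)).2.2
  rw [hy n, List.pairwise_append] at hp
  exact (hp.2.2 _ (mem m n hmn) (y n) (by simp)).1 hle

/-- The width of a well-quasi-order `A`: the rank of the tree `Inco(A)`, where a node `s` has rank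
`r(s) = sup {r(t) + 1 | t is a child of s}`, and the tree has rank `sup {r(s) + 1 | s a node}`. -/
noncomputable def width (A : Type u) [Preorder A] [WellQuasiOrderedLE A] : Ordinal.{u} :=
  ⨆ s : Inco A, IsWellFounded.rank (Inco.IsChild (A := A)) s + 1

/-! ### Natural sums -/

/-- The coefficients (natural numbers) of the base-`ω` Cantor normal form of `a`,
as a function of the exponent. -/
noncomputable def cnfCoeff (a : Ordinal.{u}) : Ordinal.{u} →₀ ℕ :=
  (Ordinal.CNF.coeff ω a).mapRange (fun c => Cardinal.toNat c.card) (by simp)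

/-- The natural (Hessenberg) sum of a finite family of ordinals: the ordinal whose Cantor normal
form is obtained by adding the Cantor normal forms of the summands coefficient by coefficient. -/
noncomputable def natSum {ι : Type v} (S : Finset ι) (f : ι → Ordinal.{u}) : Ordinal.{u} :=
  Ordinal.CNF.eval ω
    ((∑ i ∈ S, cnfCoeff (f i)).mapRange (fun c : ℕ => (c : Ordinal.{u})) Nat.cast_zero)

/-! ### Cantor normal form without multiplicities -/

/-- The ordinal sum `ω ^ e₀ + ω ^ e₁ + ⋯`, in this order, for a list of exponents `[e₀, e₁, …]`. -/
noncomputable def omegaSum (e : List Ordinal.{u}) : Ordinal.{u} :=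
  (e.map fun b => ω ^ b).sum

/-- `e = [e₀, …, e_{l-1}]` is the list of exponents of the Cantor normal form without
multiplicities of `a`: `a = ω ^ e₀ + ⋯ + ω ^ e_{l-1}` with `e₀ ≥ ⋯ ≥ e_{l-1}`. -/
structure IsCNF (a : Ordinal.{u}) (e : List Ordinal.{u}) : Prop where
  antitone : e.Pairwise (· ≥ ·)
  sum_eq : omegaSum e = a

/-- Every ordinal has a Cantor normal form without multiplicities. -/
theorem exists_isCNF (a : Ordinal.{u}) : ∃ e, IsCNF a e := by
  suffices h : ∃ e, IsCNF a e ∧ ∀ b ∈ e, b ≤ Ordinal.log ω a from h.imp fun _ h => h.1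
  induction a using WellFoundedLT.induction with
  | ind a ih =>
    by_cases ha : a = 0
    · exact ⟨[], ⟨by simp, by simp [omegaSum, ha]⟩, by simp⟩
    · have hlt := Ordinal.sub_omega0_opow_log_lt ha
      obtain ⟨e, he, hb⟩ := ih _ hlt
      have hb' : ∀ b ∈ e, b ≤ Ordinal.log ω a := fun b h =>
        (hb b h).trans (Ordinal.log_mono_right _ hlt.le)
      refine ⟨Ordinal.log ω a :: e, ⟨List.pairwise_cons.2 ⟨hb', he.antitone⟩, ?_⟩, ?_⟩
      · have h := he.sum_eq
        simp only [omegaSum, List.map_cons, List.sum_cons] at h ⊢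
        rw [h, Ordinal.add_sub_cancel_of_le (Ordinal.opow_log_le_self _ ha)]
      · simpa using hb'

/-! ### Products of ordinals and their slices -/

/-- The cartesian product `α 0 × ⋯ × α (n - 1)` of finitely many ordinals,
with the componentwise order. -/
abbrev OrdProd {n : ℕ} (α : Fin n → Ordinal.{u}) : Type u :=
  ∀ i, (α i).ToType

/-- The index set `l₁ × ⋯ × lₙ` of the slices, `lᵢ` being the length of the `i`-th normal form. -/
abbrev SliceIndex {n : ℕ} (e : Fin n → List Ordinal.{u}) : Type :=
  ∀ i, Fin (e i).length

/-- The slice with index `s`: the points `x` of the product such that, for every `i`, the ordinal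
`x i < α i` satisfies `∑_{j < s i} ω ^ e_{i,j} ≤ x i < ∑_{j ≤ s i} ω ^ e_{i,j}`. -/
def slice {n : ℕ} (α : Fin n → Ordinal.{u}) (e : Fin n → List Ordinal.{u}) (s : SliceIndex e) :
    Set (OrdProd α) :=
  {x | ∀ i, omegaSum ((e i).take (s i)) ≤ (Ordinal.ToType.toOrd (x i) : Ordinal.{u}) ∧
    (Ordinal.ToType.toOrd (x i) : Ordinal.{u}) < omegaSum ((e i).take (s i + 1))}

/-- The grounded slices: those with some coordinate index equal to `0`. -/
def grounded {n : ℕ} (e : Fin n → List Ordinal.{u}) : Finset (SliceIndex e) :=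
  {s | ∃ k, (s k : ℕ) = 0}

end OrdWidth

open OrdWidth

/-! Every slice is a translate of a product of powers of `ω`, and such a product has width a power
of `ω` (`exists_width_box_eq`). Hence the natural sum of the slice widths is their ordinary sum in
decreasing order (`natSum_eq_list_sum`).

Upper bound: subtracting its least entry from an index makes it grounded, so `X` is covered by the
diagonals `s + (k, …, k)` with `s` grounded. Slices on one diagonal are mutually comparable and
their exponents do not increase with `k`, so the diagonal is no wider than `X_s`
(`width_diagonal_le`). The width of a union is at most the natural sum of the widths
(`width_union_le`).

Lower bound: list the grounded slices by decreasing width, no slice above a later one. An antichain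
is built in the last slice, then in the one before it, and so on (`add_width_le`). Finitely many
points `f` of later slices leave enough of `X_s`: some coordinate of `f` exceeds all of `X_s`, and
where the slice of `f` has index `0` a translate of `X_s` exceeds `f`. Translating stays inside
`X_s` because the leading exponents are nonzero, which is where infinitude of the `α i` enters. -/

namespace OrdWidth

/-! ### Width as a recursion over residuals -/

section Width

variable {A : Type u} [Preorder A]

/-- The elements incomparable to `x`. -/
def inc (x : A) : Set A := {y | IncompRel (· ≤ ·) x y}

/-- The node `[x]`. -/
def Inco.single (x : A) : Inco A := ⟨[x], by simp, by simp⟩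

/-- Prepending `x` to a node of the tree of the elements incomparable to `x`. -/
def Inco.cons (x : A) (s : Inco (inc x)) : Inco A :=
  ⟨x :: s.1.map Subtype.val, by simp, by
    rw [List.pairwise_cons]
    refine ⟨?_, ?_⟩
    · intro y hy
      obtain ⟨z, -, rfl⟩ := List.mem_map.1 hy
      exact z.2
    · rw [List.pairwise_map]
      exact s.2.2⟩

theorem Inco.exists_eq_cons_of_isChild {x : A} {s : Inco (inc x)} {t : Inco A}
    (h : t.IsChild (Inco.cons x s)) : ∃ s' : Inco (inc x), s'.IsChild s ∧ t = Inco.cons x s' := by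
  obtain ⟨y, hy⟩ := h
  have ht := t.2.2
  rw [hy] at ht
  have hxy : y ∈ inc x := (List.pairwise_append.1 ht).2.2 x (by simp [Inco.cons]) y (by simp)
  have hp : (s.1 ++ [(⟨y, hxy⟩ : inc x)]).Pairwise (IncompRel (· ≤ ·)) := by
    have h2 : ((s.1 ++ [(⟨y, hxy⟩ : inc x)]).map Subtype.val).Pairwise (IncompRel (· ≤ ·)) := by
      simp only [Inco.cons, List.cons_append, List.pairwise_cons] at ht
      simpa using ht.2
    rw [List.pairwise_map] at h2
    exact h2
  refine ⟨(⟨s.1 ++ [(⟨y, hxy⟩ : inc x)], by simp, hp⟩ : Inco (inc x)), ⟨⟨y, hxy⟩, rfl⟩,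
    Subtype.ext ?_⟩
  rw [hy]
  simp [Inco.cons]

theorem Inco.isChild_cons {x : A} {s t : Inco (inc x)} (h : t.IsChild s) :
    (Inco.cons x t).IsChild (Inco.cons x s) := by
  obtain ⟨y, hy⟩ := h
  exact ⟨y, by simp [Inco.cons, hy]⟩

theorem Inco.eq_single_or_exists_cons (s : Inco A) :
    ∃ x, s = Inco.single x ∨ ∃ t, s = Inco.cons x t := by
  obtain ⟨l, hl, hp⟩ := s
  obtain _ | ⟨x, l⟩ := l
  · exact absurd rfl hl
  refine ⟨x, ?_⟩
  obtain rfl | hl' := eq_or_ne l []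
  · exact Or.inl rfl
  rw [List.pairwise_cons] at hp
  refine Or.inr ⟨⟨l.attach.map fun y => ⟨y.1, hp.1 y.1 y.2⟩, by simpa using hl', ?_⟩, ?_⟩
  · rw [List.pairwise_map]
    have h2 := hp.2
    rw [← List.attach_map_subtype_val l, List.pairwise_map] at h2
    exact h2
  · apply Subtype.ext
    simp [Inco.cons, Function.comp_def]

variable [WellQuasiOrderedLE A]

/-- The rank of a node of `Inco A`. -/
noncomputable abbrev Inco.rank (s : Inco A) : Ordinal.{u} :=
  IsWellFounded.rank (Inco.IsChild (A := A)) s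

theorem Inco.rank_le_of_forall {s : Inco A} {o : Ordinal.{u}}
    (h : ∀ t : Inco A, t.IsChild s → t.rank < o) : s.rank ≤ o := by
  rw [Inco.rank, IsWellFounded.rank_eq]
  exact Ordinal.iSup_le fun t => Order.succ_le_of_lt (h t.1 t.2)

theorem Inco.rank_cons (x : A) (s : Inco (inc x)) : (Inco.cons x s).rank = s.rank := by
  induction s using IsWellFounded.induction (Inco.IsChild (A := inc x)) with
  | ind s ih =>
    apply le_antisymm
    · refine Inco.rank_le_of_forall fun t ht => ?_
      obtain ⟨s', hs', rfl⟩ := Inco.exists_eq_cons_of_isChild ht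
      rw [ih s' hs']
      exact IsWellFounded.rank_lt_of_rel hs'
    · refine Inco.rank_le_of_forall fun t ht => ?_
      rw [← ih t ht]
      exact IsWellFounded.rank_lt_of_rel (Inco.isChild_cons ht)

theorem rank_lt_width (s : Inco A) : s.rank < width A :=
  (Order.lt_add_one_iff.2 le_rfl).trans_le
    (Ordinal.le_iSup (fun s : Inco A => IsWellFounded.rank (Inco.IsChild (A := A)) s + 1) s)

theorem width_le_of_rank_lt {o : Ordinal.{u}} (h : ∀ s : Inco A, s.rank < o) : width A ≤ o :=
  Ordinal.iSup_le fun s => Order.add_one_le_of_lt (h s)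

theorem Inco.rank_cons_lt_rank_single (x : A) (s : Inco (inc x)) :
    (Inco.cons x s).rank < (Inco.single x).rank := by
  obtain ⟨l, hl, hp⟩ := s
  induction l using List.reverseRecOn with
  | nil => exact absurd rfl hl
  | append_singleton l y ih =>
    obtain rfl | hl' := eq_or_ne l []
    · exact IsWellFounded.rank_lt_of_rel ⟨y, by simp [Inco.cons, Inco.single]⟩
    · refine lt_trans ?_ (ih hl' (List.pairwise_append.1 hp).1)
      exact IsWellFounded.rank_lt_of_rel ⟨y, by simp [Inco.cons]⟩

/-- The subtree above `[x]` is the tree of `inc x` with a root added. This turns width into the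
recursion `w(A) = sup (w(inc x) + 1)`, and later arguments use only this recursion. -/
theorem rank_single (x : A) : (Inco.single x).rank = width (inc x) := by
  apply le_antisymm
  · refine Inco.rank_le_of_forall fun t ht => ?_
    obtain ⟨y, hy⟩ := ht
    obtain ⟨z, rfl | ⟨t', rfl⟩⟩ := t.eq_single_or_exists_cons
    · simp [Inco.single] at hy
    · obtain rfl : z = x := by
        simp only [Inco.cons, Inco.single, List.cons_append, List.nil_append,
          List.cons.injEq] at hy
        exact hy.1
      rw [Inco.rank_cons]
      exact rank_lt_width t'
  · refine width_le_of_rank_lt fun s => ?_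
    rw [← Inco.rank_cons]
    exact Inco.rank_cons_lt_rank_single x s

theorem width_inc_lt (x : A) : width (inc x) < width A := by
  rw [← rank_single]
  exact rank_lt_width _

theorem width_le_of_forall {o : Ordinal.{u}} (h : ∀ x : A, width (inc x) < o) : width A ≤ o := by
  refine width_le_of_rank_lt fun s => ?_
  obtain ⟨x, rfl | ⟨t, rfl⟩⟩ := s.eq_single_or_exists_cons
  · rw [rank_single]
    exact h x
  · refine (Inco.rank_cons_lt_rank_single x t).trans ?_
    rw [rank_single]
    exact h x

end Width

/-- Antichain sequences of `A` are sent to antichain sequences of `B`; inductively, the residual at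
`x` maps into the residual at `f x`. -/
theorem lift_width_le {A : Type u} [Preorder A] [WellQuasiOrderedLE A] {B : Type v} [Preorder B]
    [WellQuasiOrderedLE B] (f : A → B)
    (hf : ∀ x y, IncompRel (· ≤ ·) x y → IncompRel (· ≤ ·) (f x) (f y)) :
    Ordinal.lift.{v} (width A) ≤ Ordinal.lift.{u} (width B) := by
  obtain ⟨o, ho⟩ : ∃ o, width A = o := ⟨_, rfl⟩
  induction o using WellFoundedLT.induction generalizing A B with
  | ind o ih =>
    by_contra! hlt
    -- If the inequality failed, the width of `B` would have a copy `β` in the universe of `A`, so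
    -- the recursion can be applied with bound `β`.
    obtain ⟨β, hβ⟩ := Ordinal.mem_range_lift_of_le hlt.le
    have hβA : β < width A := by rwa [← hβ, Ordinal.lift_lt] at hlt
    refine hβA.not_ge (width_le_of_forall fun x => ?_)
    rw [← Ordinal.lift_lt.{v}, hβ]
    refine lt_of_le_of_lt ?_ (Ordinal.lift_lt.2 (width_inc_lt (f x)))
    exact ih _ (ho ▸ width_inc_lt x) (fun y : inc x => (⟨f y, hf _ _ y.2⟩ : inc (f x)))
      (fun y z h => hf _ _ h) rfl

/-! ### Widths of subsets, and the bounds for unions of pieces -/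

section Sets

variable {A : Type u} [Preorder A] [WellQuasiOrderedLE A] {S T U : Set A}

theorem width_le_of_mapsTo {B : Type u} [Preorder B] [WellQuasiOrderedLE B] {T : Set B}
    (f : A → B) (hST : Set.MapsTo f S T)
    (hf : ∀ x ∈ S, ∀ y ∈ S, IncompRel (· ≤ ·) x y → IncompRel (· ≤ ·) (f x) (f y)) :
    width S ≤ width T := by
  have := lift_width_le (fun x : S => (⟨f x, hST x.2⟩ : T)) (fun x y h => hf _ x.2 _ y.2 h)
  simpa using this

theorem width_mono (h : S ⊆ T) : width S ≤ width T :=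
  width_le_of_mapsTo id h fun _ _ _ _ h => h

theorem width_inter_inc_lt {x : A} (hx : x ∈ S) : width ↥(S ∩ inc x) < width S := by
  refine lt_of_le_of_lt ?_ (width_inc_lt (⟨x, hx⟩ : S))
  have := lift_width_le (fun y : ↥(S ∩ inc x) => (⟨⟨y, y.2.1⟩, y.2.2⟩ : inc (⟨x, hx⟩ : S)))
    (fun y z h => h)
  simpa using this

theorem width_set_le_of_forall {o : Ordinal.{u}} (h : ∀ x ∈ S, width ↥(S ∩ inc x) < o) :
    width S ≤ o := by
  refine width_le_of_forall fun x => lt_of_le_of_lt ?_ (h x x.2)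
  have := lift_width_le (fun y : inc x => (⟨y, y.1.2, y.2⟩ : ↥(S ∩ inc (x : A))))
    (fun y z h => h)
  simpa using this

theorem exists_le_width_of_lt {o : Ordinal.{u}} (h : o < width S) :
    ∃ x ∈ S, o ≤ width ↥(S ∩ inc x) := by
  by_contra! H
  exact h.not_ge (width_set_le_of_forall H)

theorem width_pos (h : S.Nonempty) : 0 < width S :=
  h.elim fun _ hx => (zero_le).trans_lt (width_inter_inc_lt hx)

theorem width_empty : width (∅ : Set A) = 0 :=
  le_antisymm (width_set_le_of_forall (by simp)) zero_le

/-- The width of a union of mutually comparable pieces is at most that of the largest piece. -/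
theorem width_iUnion_le_of_comparable {ι : Type*} {P : ι → Set A} {o : Ordinal.{u}}
    (hP : ∀ i, width (P i) ≤ o)
    (hc : ∀ i j, i ≠ j → ∀ x ∈ P i, ∀ y ∈ P j, ¬ IncompRel (· ≤ ·) x y) :
    width ↥(⋃ i, P i) ≤ o := by
  refine width_set_le_of_forall fun x hx => ?_
  obtain ⟨i, hi⟩ := Set.mem_iUnion.1 hx
  refine lt_of_le_of_lt (width_mono ?_) ((width_inter_inc_lt hi).trans_le (hP i))
  rintro y ⟨hy, hxy⟩
  obtain ⟨j, hj⟩ := Set.mem_iUnion.1 hy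
  by_cases hij : i = j
  · subst hij
    exact ⟨hj, hxy⟩
  · exact absurd hxy (hc i j hij x hi y hj)

/-- Exhausting antichains of `T` first, while a part of `U` of width at least `o` always remains
available. -/
theorem add_width_le {o : Ordinal.{u}} (hU : U ⊆ S) (hT : T ⊆ S)
    (h : ∀ F : Finset A, (F : Set A) ⊆ T → o ≤ width ↥(U ∩ {y | ∀ x ∈ F, y ∈ inc x})) :
    o + width T ≤ width S := by
  obtain ⟨a, ha⟩ : ∃ a, width T = a := ⟨_, rfl⟩
  induction a using WellFoundedLT.induction generalizing S T U with
  | ind a ih =>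
    have h0 : o ≤ width S := (h ∅ (by simp)).trans (width_mono (Set.inter_subset_left.trans hU))
    obtain h0' | h0' := eq_or_ne (width T) 0
    · simpa [h0'] using h0
    refine Ordinal.add_le_iff h0' |>.2 fun c hc => ?_
    obtain ⟨x, hx, hcx⟩ := exists_le_width_of_lt hc
    refine lt_of_le_of_lt ?_ (width_inter_inc_lt (hT hx))
    refine (add_le_add_right hcx o).trans ?_
    -- Choosing `x` cuts both `T` and `U` down to `inc x`; a finite `F` in the smaller `T` is
    -- handled by the hypothesis for `insert x F`.
    refine ih _ (ha ▸ width_inter_inc_lt hx) (U := U ∩ inc x)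
      (Set.inter_subset_inter_left _ hU) (Set.inter_subset_inter_left _ hT) ?_ rfl
    intro F hF
    classical
    refine (h (insert x F) ?_).trans (width_mono ?_)
    · intro y hy
      rw [Finset.coe_insert, Set.mem_insert_iff] at hy
      obtain rfl | hy := hy
      · exact hx
      · exact (hF hy).1
    · rintro y ⟨hyU, hy⟩
      exact ⟨⟨hyU, hy x (by simp)⟩, fun z hz => hy z (by simp [hz])⟩

end Sets

/-! ### Cantor normal form coefficients and their order -/

section Coefficients

/-- The ordinal with given base-`ω` coefficients. -/
noncomputable def ofCoeff (f : Ordinal.{u} →₀ ℕ) : Ordinal.{u} :=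
  Ordinal.CNF.eval ω (f.mapRange (fun c : ℕ => (c : Ordinal.{u})) Nat.cast_zero)

theorem support_mapRange_natCast (f : Ordinal.{u} →₀ ℕ) :
    (f.mapRange (fun c : ℕ => (c : Ordinal.{u})) Nat.cast_zero).support = f.support :=
  Finsupp.support_mapRange_of_injective _ _ Nat.cast_injective

theorem ofCoeff_zero : ofCoeff (0 : Ordinal.{u} →₀ ℕ) = 0 := by
  simp [ofCoeff]

theorem ofCoeff_single (e : Ordinal.{u}) (k : ℕ) :
    ofCoeff (Finsupp.single e k) = ω ^ e * k := by
  simp [ofCoeff]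

theorem ofCoeff_add {f g : Ordinal.{u} →₀ ℕ}
    (h : ∀ e₁ ∈ f.support, ∀ e₂ ∈ g.support, e₂ ≤ e₁) :
    ofCoeff (f + g) = ofCoeff f + ofCoeff g := by
  rw [ofCoeff, Finsupp.mapRange_add Nat.cast_add, Ordinal.CNF.eval_add]
  · rfl
  · simpa only [support_mapRange_natCast] using h

theorem ofCoeff_lt {f : Ordinal.{u} →₀ ℕ} {o : Ordinal.{u}} (h : ∀ e ∈ f.support, e < o) :
    ofCoeff f < ω ^ o :=
  Ordinal.CNF.eval_lt (fun e => by simp) (by rwa [support_mapRange_natCast])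

theorem cnf_coeff_lt_omega0 (a e : Ordinal.{u}) : Ordinal.CNF.coeff ω a e < ω := by
  by_cases h : e ∈ (Ordinal.CNF ω a).map Prod.fst
  · obtain ⟨⟨e, c⟩, hc, rfl⟩ := List.mem_map.1 h
    rw [Ordinal.CNF.coeff_of_mem_CNF hc]
    exact Ordinal.CNF.snd_lt Ordinal.one_lt_omega0 hc
  · rw [Ordinal.CNF.coeff_of_notMem_CNF h]
    exact Ordinal.omega0_pos

theorem cast_cnfCoeff (a : Ordinal.{u}) :
    (cnfCoeff a).mapRange (fun c : ℕ => (c : Ordinal.{u})) Nat.cast_zero =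
      Ordinal.CNF.coeff ω a := by
  ext e
  obtain ⟨m, hm⟩ := Ordinal.lt_omega0.1 (cnf_coeff_lt_omega0 a e)
  simp [cnfCoeff, hm]

theorem ofCoeff_cnfCoeff (a : Ordinal.{u}) : ofCoeff (cnfCoeff a) = a := by
  rw [ofCoeff, cast_cnfCoeff, Ordinal.CNF.eval_coeff]

theorem cnfCoeff_ofCoeff (f : Ordinal.{u} →₀ ℕ) : cnfCoeff (ofCoeff f) = f := by
  ext e
  have h := Ordinal.CNF.coeff_eval Ordinal.one_lt_omega0
    (f := f.mapRange (fun c : ℕ => (c : Ordinal.{u})) Nat.cast_zero) (by simp)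
  simp [cnfCoeff, ofCoeff, h]

theorem cnfCoeff_opow (e : Ordinal.{u}) : cnfCoeff (ω ^ e) = Finsupp.single e 1 := by
  rw [← cnfCoeff_ofCoeff (Finsupp.single e 1), ofCoeff_single, Nat.cast_one, mul_one]

theorem lt_of_mem_support_cnfCoeff {a o : Ordinal.{u}} (h : a < ω ^ o) :
    ∀ e ∈ (cnfCoeff a).support, e < o := by
  intro e he
  by_contra! hoe
  rw [← support_mapRange_natCast, cast_cnfCoeff, Finsupp.mem_support_iff] at he
  exact he (Ordinal.CNF.coeff_eq_zero_of_lt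
    (h.trans_le (Ordinal.opow_le_opow_right Ordinal.omega0_pos hoe)))

/-- Split at the exponent `e`: the parts above agree, and everything below `e` in `f` is less than a
single `ω ^ e`. -/
theorem ofCoeff_lt_of_coeff_lt {f g : Ordinal.{u} →₀ ℕ} {e : Ordinal.{u}} (he : f e < g e)
    (h : ∀ e', e < e' → f e' = g e') : ofCoeff f < ofCoeff g := by
  have key : ∀ p : Ordinal.{u} →₀ ℕ, ofCoeff p =
      ofCoeff (p.filter (e < ·)) + (ω ^ e * (p e : Ordinal.{u}) + ofCoeff (p.filter (· < e))) := by
    intro p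
    have hp : p = p.filter (e < ·) + (Finsupp.single e (p e) + p.filter (· < e)) := by
      ext x
      rcases lt_trichotomy x e with hx | rfl | hx
      · simp [hx, hx.not_gt, Finsupp.single_eq_of_ne hx.ne]
      · simp
      · simp [hx, hx.not_gt, Finsupp.single_eq_of_ne hx.ne']
    conv_lhs => rw [hp]
    have hlow : ∀ x ∈ (p.filter (· < e)).support, x < e := by
      intro x hx
      rw [Finsupp.support_filter, Finset.mem_filter] at hx
      exact hx.2
    rw [ofCoeff_add, ofCoeff_add, ofCoeff_single]
    · intro e₁ h₁ e₂ h₂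
      rw [Finset.mem_singleton.1 (Finsupp.support_single_subset h₁)]
      exact (hlow _ h₂).le
    · intro e₁ h₁ e₂ h₂
      rw [Finsupp.support_filter, Finset.mem_filter] at h₁
      rcases Finset.mem_union.1 (Finsupp.support_add h₂) with h₂ | h₂
      · rw [Finset.mem_singleton.1 (Finsupp.support_single_subset h₂)]
        exact h₁.2.le
      · exact ((hlow _ h₂).trans h₁.2).le
  have hhigh : f.filter (e < ·) = g.filter (e < ·) := by
    ext x
    by_cases hx : e < x
    · simp [hx, h x hx]
    · simp [hx]
  rw [key f, key g, hhigh]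
  refine (add_lt_add_iff_left _).2 ?_
  have hlow : ofCoeff (f.filter (· < e)) < ω ^ e := by
    refine ofCoeff_lt fun x hx => ?_
    rw [Finsupp.support_filter, Finset.mem_filter] at hx
    exact hx.2
  calc ω ^ e * (f e : Ordinal.{u}) + ofCoeff (f.filter (· < e))
      < ω ^ e * (f e : Ordinal.{u}) + ω ^ e := (add_lt_add_iff_left _).2 hlow
    _ = ω ^ e * ((f e + 1 : ℕ) : Ordinal.{u}) := by
        rw [Nat.cast_add, Nat.cast_one, mul_add, mul_one]
    _ ≤ ω ^ e * (g e : Ordinal.{u}) := by gcongr; exact he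
    _ ≤ _ := le_self_add

theorem ofCoeff_lt_iff {f g : Ordinal.{u} →₀ ℕ} :
    ofCoeff f < ofCoeff g ↔ ∃ e, f e < g e ∧ ∀ e', e < e' → f e' = g e' := by
  refine ⟨fun hlt => ?_, fun ⟨e, he, h⟩ => ofCoeff_lt_of_coeff_lt he h⟩
  have hne : (f.neLocus g).Nonempty := by
    rw [Finsupp.nonempty_neLocus_iff]
    rintro rfl
    exact hlt.false
  have hmax : ∀ e', (f.neLocus g).max' hne < e' → f e' = g e' := by
    intro e' he'
    by_contra hfg
    exact he'.not_ge (Finset.le_max' _ _ (Finsupp.mem_neLocus.2 hfg))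
  refine ⟨(f.neLocus g).max' hne, ?_, hmax⟩
  rcases lt_or_gt_of_ne (Finsupp.mem_neLocus.1 ((f.neLocus g).max'_mem hne)) with h | h
  · exact h
  · exact absurd (ofCoeff_lt_of_coeff_lt h fun e' he' => (hmax e' he').symm) hlt.not_gt

/-- Adding `k` to both sides does not move the largest exponent at which they differ. This is strict
monotonicity of the natural sum. -/
theorem ofCoeff_add_lt_add_right {f g : Ordinal.{u} →₀ ℕ} (h : ofCoeff f < ofCoeff g)
    (k : Ordinal.{u} →₀ ℕ) : ofCoeff (f + k) < ofCoeff (g + k) := by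
  obtain ⟨e, he, h⟩ := ofCoeff_lt_iff.1 h
  exact ofCoeff_lt_iff.2 ⟨e, by simpa using he, fun e' he' => by simp [h e' he']⟩

theorem ofCoeff_sum_single {ι : Type v} (γ : ι → Ordinal.{u}) (L : List ι)
    (hL : L.Pairwise fun s t => γ t ≤ γ s) :
    ofCoeff (L.map fun s => Finsupp.single (γ s) 1).sum = (L.map fun s => ω ^ γ s).sum := by
  induction L with
  | nil => simp [ofCoeff_zero]
  | cons s L ih =>
    rw [List.pairwise_cons] at hL
    rw [List.map_cons, List.sum_cons, List.map_cons, List.sum_cons, ofCoeff_add, ih hL.2,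
      ofCoeff_single, Nat.cast_one, mul_one]
    intro e₁ h₁ e₂ h₂
    rw [Finset.mem_singleton.1 (Finsupp.support_single_subset h₁)]
    have : ∀ M : List ι, (∀ t ∈ M, γ t ≤ γ s) →
        ∀ e ∈ (M.map fun s => Finsupp.single (γ s) (1 : ℕ)).sum.support, e ≤ γ s := by
      intro M hM
      induction M with
      | nil => simp
      | cons t M ihM =>
        intro e he
        rw [List.map_cons, List.sum_cons] at he
        rcases Finset.mem_union.1 (Finsupp.support_add he) with he | he
        · rw [Finset.mem_singleton.1 (Finsupp.support_single_subset he)]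
          exact hM t (by simp)
        · exact ihM (fun t ht => hM t (by simp [ht])) e he
    exact this L hL.1 e₂ h₂

end Coefficients

/-! ### Width of a union against the natural sum -/

section Union

variable {A : Type u} [Preorder A] [WellQuasiOrderedLE A]

/-- A point of `S` strictly lowers the width of `S` and does not raise that of `T`, and
symmetrically. Either way the natural sum strictly drops, so induction on it applies. -/
theorem width_union_le {S T : Set A} {f g : Ordinal.{u} →₀ ℕ} (hS : width S ≤ ofCoeff f)
    (hT : width T ≤ ofCoeff g) : width ↥(S ∪ T) ≤ ofCoeff (f + g) := by
  obtain ⟨a, ha⟩ : ∃ a, ofCoeff (f + g) = a := ⟨_, rfl⟩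
  induction a using WellFoundedLT.induction generalizing S T f g with
  | ind a ih =>
    refine width_set_le_of_forall fun x hx => ?_
    rw [Set.union_inter_distrib_right]
    have hS' := width_mono (Set.inter_subset_left (s := S) (t := inc x))
    have hT' := width_mono (Set.inter_subset_left (s := T) (t := inc x))
    rcases hx with hx | hx
    · have h1 := (width_inter_inc_lt hx).trans_le hS
      have h2 := h1
      rw [← ofCoeff_cnfCoeff (width ↥(S ∩ inc x))] at h2
      have h3 := ofCoeff_add_lt_add_right h2 g
      exact (ih _ (ha ▸ h3) (ofCoeff_cnfCoeff _).ge (hT'.trans hT) rfl).trans_lt h3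
    · have h1 := (width_inter_inc_lt hx).trans_le hT
      have h2 := h1
      rw [← ofCoeff_cnfCoeff (width ↥(T ∩ inc x))] at h2
      have h3 := ofCoeff_add_lt_add_right h2 f
      rw [add_comm, add_comm g] at h3
      exact (ih _ (ha ▸ h3) (hS'.trans hS) (ofCoeff_cnfCoeff _).ge rfl).trans_lt h3

theorem width_union_lt_opow {S T : Set A} {o : Ordinal.{u}} (hS : width S < ω ^ o)
    (hT : width T < ω ^ o) : width ↥(S ∪ T) < ω ^ o := by
  refine (width_union_le (ofCoeff_cnfCoeff _).ge (ofCoeff_cnfCoeff _).ge).trans_lt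
    (ofCoeff_lt fun e he => ?_)
  rcases Finset.mem_union.1 (Finsupp.support_add he) with he | he
  · exact lt_of_mem_support_cnfCoeff hS e he
  · exact lt_of_mem_support_cnfCoeff hT e he

theorem width_biUnion_le {ι : Type v} (L : List ι) (P : ι → Set A) (f : ι → Ordinal.{u} →₀ ℕ)
    (h : ∀ i ∈ L, width (P i) ≤ ofCoeff (f i)) :
    width ↥{x | ∃ i ∈ L, x ∈ P i} ≤ ofCoeff (L.map f).sum := by
  induction L with
  | nil =>
    refine width_set_le_of_forall fun x hx => ?_
    obtain ⟨i, hi, -⟩ := hx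
    simp at hi
  | cons i L ih =>
    rw [List.map_cons, List.sum_cons]
    refine le_trans (width_mono ?_) (width_union_le (h i (by simp))
      (ih fun j hj => h j (by simp [hj])))
    rintro x ⟨j, hj, hx⟩
    rcases List.mem_cons.1 hj with rfl | hj
    · exact Or.inl hx
    · exact Or.inr ⟨j, hj, hx⟩

end Union

/-! ### Products of powers of `ω` have indecomposable width -/

section Box

variable {n : ℕ} {S T U : Set (Fin n → Ordinal.{u})}

theorem width_le_of_coord (φ : Fin n → Ordinal.{u} → Ordinal.{u})
    (hST : ∀ x ∈ S, (fun i => φ i (x i)) ∈ T)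
    (hφ : ∀ x ∈ S, ∀ y ∈ S, ∀ i, φ i (x i) ≤ φ i (y i) → x i ≤ y i) : width S ≤ width T :=
  width_le_of_mapsTo (fun x i => φ i (x i)) hST fun x hx y hy h =>
    ⟨fun hxy => h.1 fun i => hφ x hx y hy i (hxy i), fun hxy => h.2 fun i => hφ y hy x hx i (hxy i)⟩

/-- Left translation by `c` reflects the order and carries `U` into the part incomparable to `F`:
below each `f` in one coordinate, above it in another. -/
theorem width_le_width_inter_inc {F : Finset (Fin n → Ordinal.{u})} (c : Fin n → Ordinal.{u})
    (hc : ∀ x ∈ U, (fun i => c i + x i) ∈ U) (hlow : ∀ f ∈ F, ∃ j, ∀ x ∈ U, x j < f j)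
    (hhigh : ∀ f ∈ F, ∃ k, ∀ x ∈ U, f k < c k + x k) :
    width U ≤ width ↥(U ∩ {y | ∀ f ∈ F, y ∈ inc f}) := by
  refine width_le_of_coord (fun i z => c i + z) (fun x hx => ⟨hc x hx, fun f hf => ⟨?_, ?_⟩⟩)
    (fun x _ y _ i h => le_of_add_le_add_left h)
  · intro hle
    obtain ⟨j, hj⟩ := hlow f hf
    exact (hj _ (hc x hx)).not_ge (hle j)
  · intro hle
    obtain ⟨k, hk⟩ := hhigh f hf
    exact (hk x hx).not_ge (hle k)

theorem exists_lt_opow_forall_lt {b : Ordinal.{u}} (hb : b ≠ 0) (G : Finset Ordinal.{u}) :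
    ∃ c < ω ^ b, ∀ x ∈ G, x < ω ^ b → x < c := by
  classical
  induction G using Finset.induction_on with
  | empty => exact ⟨0, Ordinal.opow_pos _ Ordinal.omega0_pos, by simp⟩
  | insert a G _ ih =>
    obtain ⟨c, hc, h⟩ := ih
    by_cases ha : a < ω ^ b
    · have h1 : (1 : Ordinal.{u}) < ω ^ b := by
        simpa using (Ordinal.opow_lt_opow_iff_right Ordinal.one_lt_omega0).2
          (pos_iff_ne_zero.2 hb)
      refine ⟨max c (a + 1), max_lt hc (Ordinal.isPrincipal_add_omega0_opow b ha h1), ?_⟩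
      intro x hx hxb
      rcases Finset.mem_insert.1 hx with rfl | hx
      · exact lt_max_of_lt_right (Order.lt_add_one_iff.2 le_rfl)
      · exact lt_max_of_lt_left (h x hx hxb)
    · refine ⟨c, hc, fun x hx hxb => ?_⟩
      rcases Finset.mem_insert.1 hx with rfl | hx
      · exact absurd hxb ha
      · exact h x hx hxb

/-- The product of the ordinals `ω ^ b i`. -/
def box (b : Fin n → Ordinal.{u}) : Set (Fin n → Ordinal.{u}) :=
  {x | ∀ i, x i < ω ^ b i}

theorem box_nonempty (b : Fin n → Ordinal.{u}) : (box b).Nonempty :=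
  ⟨0, fun _ => Ordinal.opow_pos _ Ordinal.omega0_pos⟩

theorem box_mono {b b' : Fin n → Ordinal.{u}} (h : b ≤ b') : box b ⊆ box b' := fun _ hx i =>
  (hx i).trans_le (Ordinal.opow_le_opow_right Ordinal.omega0_pos (h i))

/-- `N` copies are stacked along coordinate `j`. Upper copies are used up while the bottom one
survives: it lies below them in coordinate `j`, and coordinate `k` has room to translate past
finitely many points. -/
theorem width_box_update_mul_le (b : Fin n → Ordinal.{u}) {j k : Fin n} (hjk : k ≠ j)
    (hk : b k ≠ 0) (d : Ordinal.{u}) (N : ℕ) :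
    width (box (Function.update b j d)) * N ≤
      width ↥{x : Fin n → Ordinal.{u} | x j < ω ^ d * N ∧ ∀ i, i ≠ j → x i < ω ^ b i} := by
  induction N with
  | zero => simp
  | succ N ih =>
    have hN : ω ^ d * ((N + 1 : ℕ) : Ordinal.{u}) = ω ^ d + ω ^ d * (N : Ordinal.{u}) := by
      rw [add_comm N 1, Nat.cast_add, Nat.cast_one, mul_add, mul_one]
    -- The extra summand must stand on the left: it is the bottom copy, exhausted last.
    rw [add_comm N 1, Nat.cast_add, Nat.cast_one, mul_add, mul_one, add_comm 1 N]
    refine le_trans (add_le_add_right (ih.trans ?_) _) (add_width_le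
      (T := {x | ω ^ d ≤ x j ∧ x j < ω ^ d * (N + 1 : ℕ) ∧ ∀ i, i ≠ j → x i < ω ^ b i})
      (U := box (Function.update b j d)) ?_ ?_ ?_)
    · refine width_le_of_coord (fun i z => if i = j then ω ^ d + z else z) ?_ ?_
      · rintro x ⟨hxj, hx⟩
        refine ⟨by simp, ?_, fun i hi => by simpa [hi] using hx i hi⟩
        rw [hN]
        simpa using hxj
      · intro x _ y _ i h
        by_cases hi : i = j
        · simpa [hi] using h
        · simpa [hi] using h
    · intro x hx
      refine ⟨?_, fun i hi => by simpa [hi] using hx i⟩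
      have := hx j
      rw [Function.update_self] at this
      rw [hN]
      exact this.trans_le le_self_add
    · rintro x ⟨-, hx⟩
      exact hx
    · intro F hF
      classical
      obtain ⟨c, hc, hcF⟩ := exists_lt_opow_forall_lt hk (F.image fun f => f k)
      refine width_le_width_inter_inc (fun i => if i = k then c else 0) ?_ ?_ ?_
      · intro x hx i
        have hxi := hx i
        by_cases hi : i = k
        · subst hi
          rw [Function.update_of_ne hjk] at hxi ⊢
          simpa using Ordinal.isPrincipal_add_omega0_opow _ hc hxi
        · simpa [hi] using hxi
      · intro f hf
        refine ⟨j, fun x hx => ?_⟩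
        have := hx j
        rw [Function.update_self] at this
        exact this.trans_le (hF hf).1
      · intro f hf
        refine ⟨k, fun x _ => ?_⟩
        rw [if_pos rfl]
        exact (hcF _ (Finset.mem_image_of_mem _ hf) ((hF hf).2.2 k hjk)).trans_le le_self_add

theorem opow_succ_le_width_box {b : Fin n → Ordinal.{u}} {j k : Fin n} (hjk : k ≠ j)
    (hk : b k ≠ 0) {d : Ordinal.{u}} (hd : d < b j) {γ : Ordinal.{u + 1}}
    (hγ : width (box (Function.update b j d)) = ω ^ γ) : ω ^ (γ + 1) ≤ width (box b) := by
  rw [Ordinal.opow_add_one, Ordinal.mul_le_iff_of_isSuccLimit Ordinal.isSuccLimit_omega0]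
  intro m hm
  obtain ⟨N, rfl⟩ := Ordinal.lt_omega0.1 hm
  rw [← hγ]
  refine (width_box_update_mul_le b hjk hk d N).trans (width_mono ?_)
  rintro x ⟨hxj, hx⟩ i
  by_cases hi : i = j
  · subst hi
    refine hxj.trans ?_
    calc ω ^ d * (N : Ordinal.{u}) < ω ^ d * ω := by
          gcongr
          · exact Ordinal.opow_pos _ Ordinal.omega0_pos
          · exact Ordinal.natCast_lt_omega0 N
      _ = ω ^ (d + 1) := (Ordinal.opow_add_one _ _).symm
      _ ≤ ω ^ b i := Ordinal.opow_le_opow_right Ordinal.omega0_pos (Order.add_one_le_of_lt hd)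
  · exact hx i hi

/-- A power of `ω` at most `o` strictly bounds the width of `S`. -/
def HasOpowBound (o : Ordinal.{u + 1}) (S : Set (Fin n → Ordinal.{u})) : Prop :=
  ∃ ρ : Ordinal.{u + 1}, width S < ω ^ ρ ∧ ω ^ ρ ≤ o

theorem HasOpowBound.mono {o : Ordinal.{u + 1}} (h : HasOpowBound o T)
    (hST : width S ≤ width T) : HasOpowBound o S :=
  h.imp fun _ h => ⟨hST.trans_lt h.1, h.2⟩

/-- The larger of the two powers bounds both widths, and powers of `ω` are closed under natural
sums. -/
theorem HasOpowBound.union {o : Ordinal.{u + 1}} (hS : HasOpowBound o S)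
    (hT : HasOpowBound o T) : HasOpowBound o (S ∪ T) := by
  obtain ⟨ρ, hρ, hρo⟩ := hS
  obtain ⟨σ, hσ, hσo⟩ := hT
  have h1 : ω ^ ρ ≤ ω ^ max ρ σ :=
    Ordinal.opow_le_opow_right Ordinal.omega0_pos (le_max_left ρ σ)
  have h2 : ω ^ σ ≤ ω ^ max ρ σ :=
    Ordinal.opow_le_opow_right Ordinal.omega0_pos (le_max_right ρ σ)
  refine ⟨max ρ σ, width_union_lt_opow (hρ.trans_le h1) (hσ.trans_le h2), ?_⟩
  rcases max_choice ρ σ with h | h <;> rw [h] <;> assumption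

theorem hasOpowBound_empty {o : Ordinal.{u + 1}} (ho : 0 < o) :
    HasOpowBound o (∅ : Set (Fin n → Ordinal.{u})) :=
  ⟨0, by simp [width_empty], by simpa using Order.one_le_iff_pos.2 ho⟩

theorem HasOpowBound.biUnion {ι : Type*} {o : Ordinal.{u + 1}} (ho : 0 < o) (J : Finset ι)
    (P : ι → Set (Fin n → Ordinal.{u})) (h : ∀ i ∈ J, HasOpowBound o (P i)) :
    HasOpowBound o {x | ∃ i ∈ J, x ∈ P i} := by
  classical
  induction J using Finset.induction_on with
  | empty => exact (hasOpowBound_empty ho).mono (width_mono (by simp))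
  | insert i J _ ih =>
    refine ((h i (by simp)).union (ih fun j hj => h j (by simp [hj]))).mono (width_mono ?_)
    rintro x ⟨j, hj, hx⟩
    rcases Finset.mem_insert.1 hj with rfl | hj
    · exact Or.inl hx
    · exact Or.inr ⟨j, hj, hx⟩

/-- Peel off the leading `ω ^ d` of `z`. Points with `x j < ω ^ d` form a smaller box of width `ω ^
γ`, with `ω ^ (γ + 1)` still available below `width (box b)`; subtracting `ω ^ d` from the others
leads to the smaller bound `z - ω ^ d`. -/
theorem hasOpowBound_initial {b : Fin n → Ordinal.{u}}
    (ih : ∀ b' < b, ∃ γ : Ordinal.{u + 1}, width (box b') = ω ^ γ) {j k : Fin n} (hjk : k ≠ j)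
    (hk : b k ≠ 0) {z : Ordinal.{u}} (hz : z < ω ^ b j) :
    HasOpowBound (width (box b)) {x | x ∈ box b ∧ x j < z} := by
  induction z using WellFoundedLT.induction with
  | ind z ihz =>
    obtain rfl | hz0 := eq_or_ne z 0
    · exact (hasOpowBound_empty (width_pos (box_nonempty b))).mono (width_mono (by simp))
    have hlt := Ordinal.sub_omega0_opow_log_lt hz0
    have hle := Ordinal.opow_log_le_self ω hz0
    set d := Ordinal.log ω z
    have hd : d < b j := (Ordinal.opow_lt_opow_iff_right Ordinal.one_lt_omega0).1 (hle.trans_lt hz)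
    have h1 : HasOpowBound (width (box b)) (box (Function.update b j d)) := by
      obtain ⟨γ, hγ⟩ := ih (Function.update b j d) (update_lt_self_iff.2 hd)
      refine ⟨γ + 1, ?_, opow_succ_le_width_box hjk hk hd hγ⟩
      rw [hγ]
      exact (Ordinal.opow_lt_opow_iff_right Ordinal.one_lt_omega0).2 (Order.lt_add_one_iff.2 le_rfl)
    have h2 : HasOpowBound (width (box b)) {x | x ∈ box b ∧ ω ^ d ≤ x j ∧ x j < z} := by
      refine (ihz _ hlt (hlt.trans hz)).mono
        (width_le_of_coord (fun i y => if i = j then y - ω ^ d else y) ?_ ?_)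
      · rintro x ⟨hx, hxd, hxz⟩
        refine ⟨fun i => ?_, ?_⟩
        · by_cases hi : i = j
          · subst hi
            simpa using (Ordinal.sub_le_self _ _).trans_lt (hx i)
          · simpa [hi] using hx i
        · rw [← Ordinal.add_sub_cancel_of_le hxd, ← Ordinal.add_sub_cancel_of_le hle] at hxz
          simpa using hxz
      · rintro x ⟨-, hx, -⟩ y ⟨-, hy, -⟩ i h
        by_cases hi : i = j
        · subst hi
          rw [← Ordinal.add_sub_cancel_of_le hx, ← Ordinal.add_sub_cancel_of_le hy]
          simpa using h
        · simpa [hi] using h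
    refine (h1.union h2).mono (width_mono ?_)
    rintro x ⟨hx, hxz⟩
    rcases lt_or_ge (x j) (ω ^ d) with h | h
    · refine Or.inl fun i => ?_
      by_cases hi : i = j
      · subst hi
        simpa using h
      · simpa [hi] using hx i
    · exact Or.inr ⟨hx, h, hxz⟩

/-- The width of a product of additively indecomposable ordinals is additively indecomposable. -/
theorem exists_width_box_eq (b : Fin n → Ordinal.{u}) :
    ∃ γ : Ordinal.{u + 1}, width (box b) = ω ^ γ := by
  induction b using WellFoundedLT.induction with
  | ind b ih =>
    have hpos := width_pos (box_nonempty b)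
    have hres : ∀ x ∈ box b, HasOpowBound (width (box b)) (box b ∩ inc x) := by
      intro x hx
      refine (HasOpowBound.biUnion hpos (Finset.univ.filter fun j => ∃ k, k ≠ j ∧ b k ≠ 0)
        (fun j => {y | y ∈ box b ∧ y j < x j}) ?_).mono (width_mono ?_)
      · intro j hj
        obtain ⟨k, hjk, hk⟩ := (Finset.mem_filter.1 hj).2
        exact hasOpowBound_initial ih hjk hk (hx j)
      -- Incomparability gives `y j < x j` and `x k < y k`; the latter makes `y k` positive, so `b k
      -- ≠ 0`.
      · rintro y ⟨hy, hxy, hyx⟩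
        simp only [Pi.le_def, not_forall, not_le] at hxy hyx
        obtain ⟨j, hj⟩ := hxy
        obtain ⟨k, hk⟩ := hyx
        refine ⟨j, Finset.mem_filter.2 ⟨Finset.mem_univ _, k, ?_, ?_⟩, hy, hj⟩
        · rintro rfl
          exact hj.not_gt hk
        · intro hbk
          have := hy k
          rw [hbk, Ordinal.opow_zero, Order.lt_one_iff] at this
          simp [this] at hk
    have hprin : Ordinal.IsPrincipal (· + ·) (width (box b)) := by
      intro δ₁ δ₂ h₁ h₂
      obtain ⟨x₁, hx₁, hδ₁⟩ := exists_le_width_of_lt h₁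
      obtain ⟨x₂, hx₂, hδ₂⟩ := exists_le_width_of_lt h₂
      obtain ⟨ρ, hρ, hρb⟩ := hres x₁ hx₁
      obtain ⟨σ, hσ, hσb⟩ := hres x₂ hx₂
      rcases le_total ρ σ with h | h
      · refine lt_of_lt_of_le (Ordinal.isPrincipal_add_omega0_opow σ ?_ (hδ₂.trans_lt hσ)) hσb
        exact (hδ₁.trans_lt hρ).trans_le (Ordinal.opow_le_opow_right Ordinal.omega0_pos h)
      · refine lt_of_lt_of_le (Ordinal.isPrincipal_add_omega0_opow ρ (hδ₁.trans_lt hρ) ?_) hρb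
        exact (hδ₂.trans_lt hσ).trans_le (Ordinal.opow_le_opow_right Ordinal.omega0_pos h)
    rcases Ordinal.isPrincipal_add_iff_zero_or_omega0_opow.1 hprin with h | ⟨γ, h⟩
    · exact absurd h hpos.ne'
    · exact ⟨γ, h.symm⟩

end Box

/-! ### Partial sums of Cantor normal forms -/

section NormalForm

theorem omegaSum_cons (b : Ordinal.{u}) (l : List Ordinal.{u}) :
    omegaSum (b :: l) = ω ^ b + omegaSum l := by
  simp [omegaSum]

theorem omegaSum_append (l l' : List Ordinal.{u}) :
    omegaSum (l ++ l') = omegaSum l + omegaSum l' := by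
  simp [omegaSum]

theorem omegaSum_take_succ (l : List Ordinal.{u}) (j : Fin l.length) :
    omegaSum (l.take (j + 1)) = omegaSum (l.take j) + ω ^ l.get j := by
  rw [List.take_succ_eq_append_getElem j.2, omegaSum_append]
  simp [omegaSum]

theorem omegaSum_take_mono (l : List Ordinal.{u}) {j k : ℕ} (h : j ≤ k) :
    omegaSum (l.take j) ≤ omegaSum (l.take k) := by
  obtain ⟨m, rfl⟩ := Nat.exists_eq_add_of_le h
  rw [List.take_add, omegaSum_append]
  exact le_self_add

theorem exists_omegaSum_take_le_lt {l : List Ordinal.{u}} {x : Ordinal.{u}} (h : x < omegaSum l) :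
    ∃ j : Fin l.length, omegaSum (l.take j) ≤ x ∧ x < omegaSum (l.take (j + 1)) := by
  classical
  have hex : ∃ j, x < omegaSum (l.take j) := ⟨l.length, by rwa [List.take_length]⟩
  obtain ⟨m, hm⟩ : ∃ m, Nat.find hex = m + 1 := by
    refine Nat.exists_eq_succ_of_ne_zero fun h0 => ?_
    have := Nat.find_spec hex
    rw [h0] at this
    simp [omegaSum] at this
  have hlen : Nat.find hex ≤ l.length := Nat.find_min' hex (by rwa [List.take_length])
  refine ⟨⟨m, by omega⟩, not_lt.1 (Nat.find_min hex (by rw [hm]; exact Nat.lt_succ_self m)), ?_⟩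
  have := Nat.find_spec hex
  rwa [hm] at this

theorem omegaSum_lt_omega0 {l : List Ordinal.{u}} (h : ∀ b ∈ l, b = 0) : omegaSum l < ω := by
  induction l with
  | nil => simp [omegaSum]
  | cons b l ih =>
    rw [omegaSum_cons, h b (by simp), Ordinal.opow_zero]
    exact Ordinal.isPrincipal_add_omega0 Ordinal.one_lt_omega0 (ih fun c hc => h c (by simp [hc]))

theorem IsCNF.get_le_get {a : Ordinal.{u}} {l : List Ordinal.{u}} (h : IsCNF a l)
    {j k : Fin l.length} (hjk : j ≤ k) : l.get k ≤ l.get j :=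
  h.antitone.rel_get_of_le hjk

theorem IsCNF.get_ne_zero {a : Ordinal.{u}} {l : List Ordinal.{u}} (h : IsCNF a l) (ha : ω ≤ a)
    (j : Fin l.length) (hj : (j : ℕ) = 0) : l.get j ≠ 0 := by
  intro h0
  refine ha.not_gt ?_
  rw [← h.sum_eq]
  refine omegaSum_lt_omega0 fun b hb => ?_
  obtain ⟨k, rfl⟩ := List.get_of_mem hb
  have := h.get_le_get (j := j) (k := k) (Fin.le_def.2 (by omega))
  rw [h0] at this
  exact le_antisymm this zero_le

end NormalForm

/-! ### Grounded slices and the two bounds -/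

section Slices

variable {n : ℕ} {α : Fin n → Ordinal.{u}} {e : Fin n → List Ordinal.{u}}

/-- The slice with index `s`, as a set of tuples of ordinals. -/
def ordSlice (e : Fin n → List Ordinal.{u}) (s : SliceIndex e) : Set (Fin n → Ordinal.{u}) :=
  {x | ∀ i, omegaSum ((e i).take (s i)) ≤ x i ∧ x i < omegaSum ((e i).take (s i + 1))}

theorem width_ordSlice (s : SliceIndex e) :
    width (ordSlice e s) = width (box fun i => (e i).get (s i)) := by
  apply le_antisymm
  · refine width_le_of_coord (fun i x => x - omegaSum ((e i).take (s i))) ?_ ?_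
    · intro x hx i
      obtain ⟨h1, h2⟩ := hx i
      rwa [← Ordinal.add_sub_cancel_of_le h1, omegaSum_take_succ, add_lt_add_iff_left] at h2
    · intro x hx y hy i h
      rw [← Ordinal.add_sub_cancel_of_le (hx i).1, ← Ordinal.add_sub_cancel_of_le (hy i).1]
      exact (add_le_add_iff_left _).2 h
  · refine width_le_of_coord (fun i x => omegaSum ((e i).take (s i)) + x) ?_ ?_
    · intro x hx i
      rw [omegaSum_take_succ]
      exact ⟨le_self_add, (add_lt_add_iff_left _).2 (hx i)⟩
    · intro x _ y _ i h
      exact (add_le_add_iff_left _).1 h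

theorem width_ordSlice_anti (he : ∀ i, IsCNF (α i) (e i)) {s t : SliceIndex e} (h : s ≤ t) :
    width (ordSlice e t) ≤ width (ordSlice e s) := by
  rw [width_ordSlice, width_ordSlice]
  exact width_mono (box_mono fun i => (he i).get_le_get (h i))

/-- Grounded slices can be exhausted one after the other, beginning with the last one in the list,
when no slice lies above one that comes later in the list. -/
theorem sum_width_ordSlice_le (hα : ∀ i, ω ≤ α i) (he : ∀ i, IsCNF (α i) (e i))
    (L : List (SliceIndex e)) (hL : ∀ s ∈ L, s ∈ grounded e)
    (hp : L.Pairwise fun s t => ¬ t ≤ s) :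
    (L.map fun s => width (ordSlice e s)).sum ≤ width ↥{x | ∃ s ∈ L, x ∈ ordSlice e s} := by
  induction L with
  | nil => simp
  | cons s L ih =>
    rw [List.pairwise_cons] at hp
    rw [List.map_cons, List.sum_cons]
    refine (add_le_add_right (ih (fun t ht => hL t (by simp [ht])) hp.2) _).trans
      (add_width_le (U := ordSlice e s) (fun x hx => ⟨s, by simp, hx⟩) ?_ ?_)
    · rintro x ⟨t, ht, hx⟩
      exact ⟨t, by simp [ht], hx⟩
    · intro F hF
      classical
      -- Where `s i = 0`, translate past the finitely many values `f i` below the first partial sum;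
      -- elsewhere `X_s` already lies above those values and `c = 0` suffices.
      have hc : ∀ i, ∃ c : Ordinal.{u}, (∀ z, omegaSum ((e i).take (s i)) ≤ z →
          z < omegaSum ((e i).take (s i + 1)) → omegaSum ((e i).take (s i)) ≤ c + z ∧
            c + z < omegaSum ((e i).take (s i + 1))) ∧
          ∀ z, omegaSum ((e i).take (s i)) ≤ z → ∀ f ∈ F, f i < omegaSum ((e i).take 1) →
            f i < c + z := by
        intro i
        by_cases hs : (s i : ℕ) = 0
        · obtain ⟨c, hc, hcF⟩ := exists_lt_opow_forall_lt ((he i).get_ne_zero (hα i) (s i) hs)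
            (F.image fun f => f i)
          have h1 : omegaSum ((e i).take (s i + 1)) = ω ^ (e i).get (s i) := by
            rw [omegaSum_take_succ, hs]
            simp [omegaSum]
          refine ⟨c, fun z _ hz => ⟨?_, ?_⟩, fun z _ f hf hfi => ?_⟩
          · rw [hs]
            simp [omegaSum]
          · rw [h1] at hz ⊢
            exact Ordinal.isPrincipal_add_omega0_opow _ hc hz
          · rw [hs, zero_add] at h1
            rw [h1] at hfi
            exact (hcF _ (Finset.mem_image_of_mem _ hf) hfi).trans_le le_self_add
        · refine ⟨0, fun z h1 h2 => by simpa using ⟨h1, h2⟩, fun z hz f hf hfi => ?_⟩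
          rw [zero_add]
          exact hfi.trans_le ((omegaSum_take_mono _ (by omega)).trans hz)
      choose c hcU hcF using hc
      refine width_le_width_inter_inc c (fun x hx i => hcU i _ (hx i).1 (hx i).2) ?_ ?_
      · intro f hf
        obtain ⟨t, ht, hft⟩ := hF hf
        have hts := hp.1 t ht
        simp only [Pi.le_def, not_forall, not_le] at hts
        obtain ⟨i, hi⟩ := hts
        refine ⟨i, fun x hx => (hx i).2.trans_le (le_trans ?_ (hft i).1)⟩
        exact omegaSum_take_mono _ (Fin.lt_def.1 hi)
      · intro f hf
        obtain ⟨t, ht, hft⟩ := hF hf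
        have htg := hL t (by simp [ht])
        simp only [grounded, Finset.mem_filter, Finset.mem_univ, true_and] at htg
        obtain ⟨k, hk⟩ := htg
        refine ⟨k, fun x hx => hcF k _ (hx k).1 f hf ?_⟩
        have := (hft k).2
        rwa [hk, zero_add] at this

/-- The union of the slices whose index is `s + (k, …, k)` for some `k`. -/
def diagonal (e : Fin n → List Ordinal.{u}) (s : SliceIndex e) : Set (Fin n → Ordinal.{u}) :=
  ⋃ k : ℕ, {x | ∃ t : SliceIndex e, (∀ i, (t i : ℕ) = s i + k) ∧ x ∈ ordSlice e t}

theorem width_diagonal_le (he : ∀ i, IsCNF (α i) (e i)) (s : SliceIndex e) :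
    width (diagonal e s) ≤ width (ordSlice e s) := by
  refine width_iUnion_le_of_comparable (fun k => ?_) ?_
  · by_cases ht : ∃ t : SliceIndex e, ∀ i, (t i : ℕ) = s i + k
    · obtain ⟨t, ht⟩ := ht
      refine le_trans (width_mono ?_) (width_ordSlice_anti he (s := s) (t := t) fun i =>
        Fin.le_def.2 (by rw [ht i]; omega))
      rintro x ⟨t', ht', hx⟩
      obtain rfl : t' = t := funext fun i => Fin.ext (by rw [ht i, ht' i])
      exact hx
    · refine le_trans (width_mono (T := ∅) ?_) (by rw [width_empty]; exact zero_le)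
      rintro x ⟨t, h, -⟩
      exact ht ⟨t, h⟩
  · have key : ∀ j k : ℕ, j < k →
        ∀ x ∈ {x | ∃ t : SliceIndex e, (∀ i, (t i : ℕ) = s i + j) ∧ x ∈ ordSlice e t},
        ∀ y ∈ {x | ∃ t : SliceIndex e, (∀ i, (t i : ℕ) = s i + k) ∧ x ∈ ordSlice e t},
        x ≤ y := by
      rintro j k hjk x ⟨t, ht, hx⟩ y ⟨t', ht', hy⟩ i
      refine (hx i).2.le.trans (le_trans (omegaSum_take_mono _ ?_) (hy i).1)
      rw [ht, ht']
      omega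
    intro j k hjk x hx y hy hxy
    rcases lt_or_gt_of_ne hjk with h | h
    · exact hxy.1 (key j k h x hx y hy)
    · exact hxy.2 (key k j h y hy x hx)

theorem exists_mem_diagonal (hn : 1 ≤ n) {x : Fin n → Ordinal.{u}}
    (hx : ∀ i, x i < omegaSum (e i)) : ∃ s ∈ grounded e, x ∈ diagonal e s := by
  choose t ht using fun i => exists_omegaSum_take_le_lt (hx i)
  have : Nonempty (Fin n) := ⟨⟨0, hn⟩⟩
  -- The least entry `t k` measures how far along its diagonal the slice lies.
  obtain ⟨k, hk⟩ := Finite.exists_min fun i => (t i : ℕ)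
  refine ⟨fun i => ⟨t i - t k, lt_of_le_of_lt (Nat.sub_le _ _) (t i).2⟩, ?_,
    Set.mem_iUnion.2 ⟨t k, t, fun i => ?_, ht⟩⟩
  · simp only [grounded, Finset.mem_filter, Finset.mem_univ, true_and]
    exact ⟨k, Nat.sub_self _⟩
  · exact (Nat.sub_add_cancel (hk i)).symm

/-- The grounded slices, listed by decreasing width and so that no slice lies above a later one. -/
theorem exists_grounded_list (he : ∀ i, IsCNF (α i) (e i)) :
    ∃ L : List (SliceIndex e), L.Nodup ∧ (∀ s, s ∈ L ↔ s ∈ grounded e) ∧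
      L.Pairwise (fun s t => width (ordSlice e t) ≤ width (ordSlice e s)) ∧
      L.Pairwise fun s t => ¬ t ≤ s := by
  classical
  -- Sort by decreasing width, breaking ties by increasing index sum: if `t < s`, then `t` is at
  -- least as wide and has a smaller index sum, so it precedes `s`.
  let κ : SliceIndex e → (Ordinal.{u + 1})ᵒᵈ ×ₗ ℕ := fun s =>
    toLex (OrderDual.toDual (width (ordSlice e s)), ∑ i, (s i : ℕ))
  let L := (grounded e).toList.insertionSort fun s t => κ s ≤ κ t
  have hperm : L.Perm (grounded e).toList := List.perm_insertionSort _ _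
  have hnodup : L.Nodup := hperm.nodup_iff.2 (Finset.nodup_toList _)
  have : Std.Total fun s t => κ s ≤ κ t := ⟨fun s t => le_total _ _⟩
  have : IsTrans _ fun s t => κ s ≤ κ t := ⟨fun s t r => le_trans⟩
  have hsort : L.Pairwise fun s t => κ s ≤ κ t := List.pairwise_insertionSort _ _
  refine ⟨L, hnodup, fun s => by rw [hperm.mem_iff, Finset.mem_toList], hsort.imp ?_,
    (hsort.and hnodup).imp ?_⟩
  · intro s t hst
    rcases Prod.Lex.toLex_le_toLex.1 hst with h | h
    · exact le_of_lt h
    · exact (congrArg OrderDual.ofDual h.1).ge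
  · rintro s t ⟨hst, hne⟩ hts
    rcases Prod.Lex.toLex_le_toLex.1 hst with h | h
    · exact (width_ordSlice_anti he hts).not_gt h
    · obtain ⟨-, i, hi⟩ := Pi.lt_def.1 (lt_of_le_of_ne hts (Ne.symm hne))
      exact h.2.not_gt (Finset.sum_lt_sum (fun i _ => hts i) ⟨i, Finset.mem_univ i, hi⟩)

theorem width_Iio_eq_sum (hn : 1 ≤ n) (hα : ∀ i, ω ≤ α i) (he : ∀ i, IsCNF (α i) (e i))
    {L : List (SliceIndex e)} (hL : ∀ s, s ∈ L ↔ s ∈ grounded e)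
    (hw : L.Pairwise fun s t => width (ordSlice e t) ≤ width (ordSlice e s))
    (hp : L.Pairwise fun s t => ¬ t ≤ s) :
    width ↥{x : Fin n → Ordinal.{u} | ∀ i, x i < α i} =
      (L.map fun s => width (ordSlice e s)).sum := by
  apply le_antisymm
  · have hγ : ∀ s : SliceIndex e, ∃ γ : Ordinal.{u + 1}, width (ordSlice e s) = ω ^ γ :=
      fun s => by
      rw [width_ordSlice]
      exact exists_width_box_eq _
    choose γ hγ using hγ
    simp only [hγ] at hw ⊢
    rw [← ofCoeff_sum_single γ L (hw.imp fun h =>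
      (Ordinal.opow_le_opow_iff_right Ordinal.one_lt_omega0).1 h)]
    refine le_trans (width_mono ?_) (width_biUnion_le L (diagonal e) _ fun s _ => ?_)
    · intro x hx
      obtain ⟨s, hs, hxs⟩ := exists_mem_diagonal hn (e := e) (x := x) fun i => by
        rw [(he i).sum_eq]
        exact hx i
      exact ⟨s, (hL s).2 hs, hxs⟩
    · rw [ofCoeff_single, Nat.cast_one, mul_one, ← hγ]
      exact width_diagonal_le he s
  · refine (sum_width_ordSlice_le hα he L (fun s hs => (hL s).1 hs) hp).trans (width_mono ?_)
    rintro x ⟨s, -, hx⟩ i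
    refine (hx i).2.trans_le ?_
    rw [← (he i).sum_eq]
    refine (omegaSum_take_mono _ (k := (e i).length) (s i).2).trans ?_
    rw [List.take_length]

end Slices

/-! ### Transfer between tuples of ordinals and the types `OrdProd α`, one universe lower -/

section Lift

theorem lift_width_eq {A : Type u} [Preorder A] [WellQuasiOrderedLE A] {B : Type v} [Preorder B]
    [WellQuasiOrderedLE B] (f : A → B) (hf : ∀ x y, f x ≤ f y ↔ x ≤ y)
    (hsurj : Function.Surjective f) :
    Ordinal.lift.{v} (width A) = Ordinal.lift.{u} (width B) := by
  apply le_antisymm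
  · exact lift_width_le f fun x y h => by rwa [IncompRel, hf, hf]
  · refine lift_width_le (Function.surjInv hsurj) fun x y h => ?_
    have hinv := Function.surjInv_eq hsurj
    rwa [IncompRel, ← hf, ← hf, hinv, hinv]

variable {n : ℕ} (α : Fin n → Ordinal.{u}) {e : Fin n → List Ordinal.{u}}

theorem lift_width_ordProd :
    Ordinal.lift.{u + 1} (width (OrdProd α)) =
      width ↥{x : Fin n → Ordinal.{u} | ∀ i, x i < α i} := by
  rw [← Ordinal.lift_id'.{u, u + 1} (width ↥{x : Fin n → Ordinal.{u} | ∀ i, x i < α i})]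
  refine lift_width_eq (fun x => ⟨fun i => (Ordinal.ToType.toOrd (x i) : Ordinal.{u}),
    fun i => (Ordinal.ToType.toOrd (x i)).2⟩) (fun x y => ?_) ?_
  · exact forall_congr' fun i => (Ordinal.ToType.mk (o := α i)).symm.le_iff_le
  · rintro ⟨x, hx⟩
    exact ⟨fun i => Ordinal.ToType.mk ⟨x i, hx i⟩, by simp⟩

theorem lift_width_slice (he : ∀ i, IsCNF (α i) (e i)) (s : SliceIndex e) :
    Ordinal.lift.{u + 1} (width (slice α e s)) = width (ordSlice e s) := by
  rw [← Ordinal.lift_id'.{u, u + 1} (width (ordSlice e s))]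
  refine lift_width_eq (fun x => (⟨fun i => (Ordinal.ToType.toOrd (x.1 i) : Ordinal.{u}), x.2⟩ :
    ordSlice e s)) (fun x y => ?_) ?_
  · exact forall_congr' fun i => (Ordinal.ToType.mk (o := α i)).symm.le_iff_le
  · rintro ⟨x, hx⟩
    have hxα : ∀ i, x i < α i := fun i => by
      refine (hx i).2.trans_le ?_
      rw [← (he i).sum_eq]
      refine (omegaSum_take_mono _ (k := (e i).length) (s i).2).trans ?_
      rw [List.take_length]
    exact ⟨⟨fun i => Ordinal.ToType.mk ⟨x i, hxα i⟩, fun i => by simpa using hx i⟩, by simp⟩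

/-- Additive indecomposability descends along `lift`, so the exponent can be found in the lower
universe. -/
theorem exists_eq_opow_of_lift {a : Ordinal.{u}} {γ : Ordinal.{max u v}}
    (h : Ordinal.lift.{v} a = ω ^ γ) : ∃ β : Ordinal.{u}, a = ω ^ β := by
  have hprin : Ordinal.IsPrincipal (· + ·) a := by
    intro b c hb hc
    rw [← Ordinal.lift_lt.{v}, h] at hb hc ⊢
    rw [Ordinal.lift_add]
    exact Ordinal.isPrincipal_add_omega0_opow γ hb hc
  rcases Ordinal.isPrincipal_add_iff_zero_or_omega0_opow.1 hprin with rfl | ⟨β, hβ⟩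
  · rw [Ordinal.lift_zero] at h
    exact absurd h (Ordinal.opow_pos _ Ordinal.omega0_pos).ne
  · exact ⟨β, hβ.symm⟩

theorem lift_list_sum (l : List Ordinal.{u}) :
    Ordinal.lift.{v} l.sum = (l.map Ordinal.lift.{v}).sum := by
  induction l with
  | nil => simp
  | cons a l ih => rw [List.sum_cons, Ordinal.lift_add, ih, List.map_cons, List.sum_cons]

/-- The natural sum of additively indecomposable ordinals is their ordinary sum in decreasing
order. -/
theorem natSum_eq_list_sum {ι : Type v} (S : Finset ι) (f : ι → Ordinal.{u})
    (hf : ∀ i, ∃ γ : Ordinal.{u}, f i = ω ^ γ) {L : List ι} (hnodup : L.Nodup) (hL : ∀ i, i ∈ L ↔ i ∈ S)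
    (hsort : L.Pairwise fun i j => f j ≤ f i) : natSum S f = (L.map f).sum := by
  classical
  choose γ hγ using hf
  obtain rfl : f = fun i => ω ^ γ i := funext hγ
  obtain rfl : S = L.toFinset := by
    ext i
    rw [List.mem_toFinset, hL]
  rw [← ofCoeff_sum_single γ L (hsort.imp fun h =>
      (Ordinal.opow_le_opow_iff_right Ordinal.one_lt_omega0).1 h),
    ← List.sum_toFinset _ hnodup]
  simp only [← cnfCoeff_opow]
  rfl

end Lift

end OrdWidth

open OrdWidth

theorem mainTheorem2 {n : ℕ} (hn : 1 ≤ n) (α : Fin n → Ordinal.{u}) (hα : ∀ i, ω ≤ α i)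
    (e : Fin n → List Ordinal.{u}) (he : ∀ i, IsCNF (α i) (e i)) :
    width (OrdProd α) = natSum (grounded e) (fun s => width (slice α e s)) := by
  obtain ⟨L, hnodup, hL, hw, hp⟩ := exists_grounded_list he
  rw [natSum_eq_list_sum _ _ _ hnodup hL]
  · rw [← Ordinal.lift_inj.{u + 1}, lift_list_sum, List.map_map, lift_width_ordProd,
      width_Iio_eq_sum hn hα he hL hw hp]
    exact congrArg List.sum (List.map_congr_left fun s _ => (lift_width_slice α he s).symm)
  · refine hw.imp fun h => ?_
    rwa [← lift_width_slice α he, ← lift_width_slice α he, Ordinal.lift_le] at h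
  · intro s
    obtain ⟨γ, hγ⟩ := exists_width_box_eq fun i => (e i).get (s i)
    rw [← width_ordSlice, ← lift_width_slice α he] at hγ
    exact exists_eq_opow_of_lift hγ
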